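/- Let $d$ be a positive integer. Call a $(d+1)$-tuple of sets $S_1,\dots,S_{d+1}\subseteq\mathbb{R}^d$ *homogeneous* with respect to a point $q\in\mathbb{R}^d$ if either $q\in\operatorname{conv}\{v_1,\dots,v_{d+1}\}$ for all $v_1\in S_1,\dots,v_{d+1}\in S_{d+1}$, or $q\notin\operatorname{conv}\{v_1,\dots,v_{d+1}\}$ for all $v_1\in S_1,\dots,v_{d+1}\in S_{d+1}$. An *equipartition* of a finite set $P$ into $k$ parts is a decomposition $P=P_1\cup\dots\cup P_k$ into pairwise disjoint sets whose sizes differ by at most one (some parts are empty if $|P|<k$). For every positive integer $d$ and every real $\epsilon>0$ there exists an integer $K=K(\epsilon,d)\ge d+1$ such that the following holds for every integer $k\ge K$. For every finite set $P\subseteq\mathbb{R}^d$ and every point $q\in\mathbb{R}^d$ there is an equipartition $P=P_1\cup\dots\cup P_k$ such that, among all $(d+1)$-tuples $(P_{i_1},\dots,P_{i_{d+1}})$ with pairwise distinct indices $i_1,\dots,i_{d+1}\in\{1,\dots,k\}$, all but at most an $\epsilon$-fraction are homogeneous with respect to $q$. -/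

import Mathlib

/-- The sets `S 0, …, S d` in `ℝ^d` are homogeneous with respect to the point `q` if either all
(closed, possibly degenerate) simplices with one vertex in each `S i` contain `q`, or none of
them does. -/
def IsHomogeneous {d : ℕ} (q : EuclideanSpace ℝ (Fin d))
    (S : Fin (d + 1) → Set (EuclideanSpace ℝ (Fin d))) : Prop :=
  (∀ v : Fin (d + 1) → EuclideanSpace ℝ (Fin d), (∀ i, v i ∈ S i) →
      q ∈ convexHull ℝ (Set.range v)) ∨
  (∀ v : Fin (d + 1) → EuclideanSpace ℝ (Fin d), (∀ i, v i ∈ S i) →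
      q ∉ convexHull ℝ (Set.range v))

/-- `A 0, …, A (k - 1)` is an equipartition of the finite set `P`: the sets are pairwise disjoint,
their union is `P`, and their sizes differ by at most one. Some parts are empty when `P` has fewer
than `k` elements. -/
structure IsEquipartitionInto {α : Type*} {k : ℕ} (P : Finset α) (A : Fin k → Finset α) :
    Prop where
  disjoint : ∀ i j, i ≠ j → Disjoint (A i) (A j)
  union_eq : (⋃ i, (A i : Set α)) = P
  card_le : ∀ i j, (A i).card ≤ (A j).card + 1

/-! The core is a selection statement: any `d + 1` nonempty finite sets contain subsets of
proportion bounded below in terms of `d` that are homogeneous with respect to `q`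
(`exists_subsets_isHomogeneous`). Membership of `q` in a simplex is determined by the signs of
finitely many determinants (`zero_mem_convexHull_of_sign_mixedDet_eq`), each affine in every vertex,
so it suffices to freeze the sign of a separately affine function on a large box
(`exists_subsets_sign_eq`). Variables are treated one at a time: the linear functionals of the new
variable are controlled by their signs at boundedly many test vectors (`exists_hasSignWitness`).

Test vectors exist because, unless half of the set lies in a proper subspace, a linear map places a
large part of it so that every hyperplane through the origin misses a fixed fraction of the points
by a fixed angle. Such a map nearly minimises `∑ log ‖T x‖ - r log |det T|`. Compactness of the
sphere then provides finitely many tests.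

To pass to partitions, the product is split along a homogeneous box and the other cells are treated
recursively; this gives a bounded colouring with few bad tuples of points
(`exists_coloring_card_filter_le`). Cutting the colour classes into equal parts leaves boundedly
many mixed parts, negligible for large `k`, while a non-homogeneous tuple of monochromatic parts
makes all of its transversals bad. -/

/-! ### Linear maps that spread out a finite set. -/

open Module in
/-- Hadamard's inequality for the standard basis of `ℝ^n`. -/
theorem abs_basisFun_det_le {n : ℕ} (v : Fin n → EuclideanSpace ℝ (Fin n)) :
    |(EuclideanSpace.basisFun (Fin n) ℝ).toBasis.det v| ≤ ∏ i, ‖v i‖ := by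
  have : Fact (finrank ℝ (EuclideanSpace ℝ (Fin n)) = n) := ⟨finrank_euclideanSpace_fin⟩
  have h := (EuclideanSpace.basisFun (Fin n) ℝ).toBasis.orientation.abs_volumeForm_apply_le v
  rwa [Orientation.volumeForm_robust' _ (EuclideanSpace.basisFun (Fin n) ℝ)] at h

/-- The logarithmic form of Hadamard's inequality for the image of a basis. -/
theorem exists_log_det_add_le_sum_log_norm {n : ℕ} {b : Fin n → EuclideanSpace ℝ (Fin n)}
    (hb : LinearIndependent ℝ b) :
    ∃ C : ℝ, ∀ T : EuclideanSpace ℝ (Fin n) →ₗ[ℝ] EuclideanSpace ℝ (Fin n), T.det ≠ 0 →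
      Real.log |T.det| + C ≤ ∑ i, Real.log ‖T (b i)‖ := by
  set e := (EuclideanSpace.basisFun (Fin n) ℝ).toBasis with he
  have hdet : e.det b ≠ 0 := by
    have := (e.is_basis_iff_det (v := b)).1
      ⟨hb, hb.span_eq_top_of_card_eq_finrank' (by simp)⟩
    exact this.ne_zero
  refine ⟨Real.log |e.det b|, fun T hT => ?_⟩
  have h := abs_basisFun_det_le (fun i => T (b i))
  have h2 : e.det (fun i => T (b i)) = T.det * e.det b := e.det_comp T b
  rw [← he, h2, abs_mul] at h
  have hTb : ∀ i, ‖T (b i)‖ ≠ 0 := by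
    intro i h0
    have : b i = 0 := by
      have hinj : Function.Injective T :=
        ((LinearMap.isUnit_iff_isUnit_det T).2 hT.isUnit |> (Module.End.isUnit_iff T).1).1
      exact hinj (by simpa using h0)
    exact hb.ne_zero i this
  rw [← Real.log_mul (by positivity) (by positivity), ← Real.log_prod (fun i _ => hTb i)]
  exact Real.log_le_log (by positivity) h

open Module in
/-- A finite set splits into disjoint bases and a remainder which does not span. -/
theorem exists_subset_log_det_le_sum_log_norm {n : ℕ} (hn : n ≠ 0)
    (X : Finset (EuclideanSpace ℝ (Fin n))) :
    ∃ Y ⊆ X, ∃ r : ℕ, ∃ C : ℝ, Y.card = r * n ∧ (0 : EuclideanSpace ℝ (Fin n)) ∉ Y ∧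
      Submodule.span ℝ ((X : Set (EuclideanSpace ℝ (Fin n))) \ Y) ≠ ⊤ ∧
      ∀ T : EuclideanSpace ℝ (Fin n) →ₗ[ℝ] EuclideanSpace ℝ (Fin n), T.det ≠ 0 →
        r * Real.log |T.det| + C ≤ ∑ x ∈ Y, Real.log ‖T x‖ := by
  classical
  induction X using Finset.strongInduction with
  | H X ih =>
  by_cases hX : Submodule.span ℝ (X : Set (EuclideanSpace ℝ (Fin n))) = ⊤
  swap
  · exact ⟨∅, by simp, 0, 0, by simp, by simp, by simpa using hX, by simp⟩
  obtain ⟨b, hbX, hb⟩ : ∃ b : Fin n → EuclideanSpace ℝ (Fin n),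
      (∀ i, b i ∈ X) ∧ LinearIndependent ℝ b := by
    obtain ⟨f, hf1, -, hf3⟩ := Submodule.exists_fun_fin_finrank_span_eq ℝ
      (X : Set (EuclideanSpace ℝ (Fin n)))
    have h : n = finrank ℝ (Submodule.span ℝ (X : Set (EuclideanSpace ℝ (Fin n)))) := by
      rw [hX, finrank_top, finrank_euclideanSpace_fin]
    exact ⟨f ∘ Fin.cast h, fun i => hf1 _, hf3.comp _ (Fin.cast_injective h)⟩
  set B := Finset.univ.image b with hB
  have hBX : B ⊆ X := by
    intro x hx
    obtain ⟨i, -, rfl⟩ := Finset.mem_image.1 hx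
    exact hbX i
  have hBcard : B.card = n := by
    rw [hB, Finset.card_image_of_injective _ hb.injective, Finset.card_univ, Fintype.card_fin]
  have hBne : B.Nonempty := by
    rw [← Finset.card_pos]; omega
  obtain ⟨Y, hYX, r, C, hYc, hY0, hYs, hYC⟩ := ih (X \ B) (Finset.sdiff_ssubset hBX hBne)
  obtain ⟨C', hC'⟩ := exists_log_det_add_le_sum_log_norm hb
  have hdisj : Disjoint Y B := Finset.disjoint_of_subset_left hYX Finset.sdiff_disjoint
  refine ⟨Y ∪ B, Finset.union_subset (hYX.trans Finset.sdiff_subset) hBX, r + 1, C + C', ?_, ?_,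
    ?_, fun T hT => ?_⟩
  · rw [Finset.card_union_of_disjoint hdisj, hYc, hBcard]; ring
  · rw [Finset.mem_union, not_or]
    refine ⟨hY0, fun h => ?_⟩
    obtain ⟨i, -, hi⟩ := Finset.mem_image.1 h
    exact hb.ne_zero i hi
  · convert hYs using 2
    ext x
    simp only [Finset.coe_union, Finset.coe_sdiff, Set.mem_sdiff, Set.mem_union]
    tauto
  · rw [Finset.sum_union hdisj, hB, Finset.sum_image (fun i _ j _ h => hb.injective h)]
    have h1 := hYC T hT
    have h2 := hC' T hT
    push_cast
    linarith

/-- A finite set which is a disjoint union of bases is spread out in suitable coordinates: a fixed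
fraction of its points is far from any given hyperplane. -/
theorem exists_linearMap_le_card_filter_inner {n : ℕ} (hn : n ≠ 0) {δ : ℝ}
    (hδ : 12 * n * δ ^ 2 ≤ 1) (Y : Finset (EuclideanSpace ℝ (Fin n))) (r : ℕ) (C : ℝ)
    (hYc : Y.card = r * n) (hY0 : (0 : EuclideanSpace ℝ (Fin n)) ∉ Y)
    (hYC : ∀ T : EuclideanSpace ℝ (Fin n) →ₗ[ℝ] EuclideanSpace ℝ (Fin n), T.det ≠ 0 →
      r * Real.log |T.det| + C ≤ ∑ x ∈ Y, Real.log ‖T x‖) :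
    ∃ T : EuclideanSpace ℝ (Fin n) →ₗ[ℝ] EuclideanSpace ℝ (Fin n), T.det ≠ 0 ∧
      ∀ u : EuclideanSpace ℝ (Fin n), ‖u‖ = 1 →
        (Y.card : ℝ) / (2 * n) ≤ (Y.filter fun x => δ * ‖T x‖ ≤ |inner ℝ u (T x)|).card := by
  classical
  rcases Nat.eq_zero_or_pos r with rfl | hr
  · have : Y.card = 0 := by simpa using hYc
    exact ⟨LinearMap.id, by simp, fun u _ => by rw [this]; simp⟩
  have hlog2 : (1 / 2 : ℝ) < Real.log 2 := by linarith [Real.log_two_gt_d9]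
  -- This energy is invariant under scaling of `T` because `Y` has `r * n` points. A minimiser need
  -- not exist; a map within `r log 2 / 4` of the infimum suffices.
  set Φ : (EuclideanSpace ℝ (Fin n) →ₗ[ℝ] EuclideanSpace ℝ (Fin n)) → ℝ :=
    fun T => ∑ x ∈ Y, Real.log ‖T x‖ - r * Real.log |T.det| with hΦ
  have hbdd : BddBelow (Φ '' {T | T.det ≠ 0}) := by
    refine ⟨C, ?_⟩
    rintro _ ⟨T, hT, rfl⟩
    have := hYC T hT
    simp only [hΦ]; linarith
  have hne : (Φ '' {T | T.det ≠ 0}).Nonempty := ⟨Φ LinearMap.id, LinearMap.id, by simp, rfl⟩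
  have hr' : (0 : ℝ) < r := by exact_mod_cast hr
  have hn' : (0 : ℝ) < n := by exact_mod_cast Nat.pos_of_ne_zero hn
  obtain ⟨_, ⟨T, hT, rfl⟩, hTlt⟩ := Real.lt_sInf_add_pos hne
    (show 0 < (r : ℝ) * Real.log 2 / 4 by positivity)
  refine ⟨T, hT, fun u hu => ?_⟩
  by_contra! hcon
  -- `S` stretches by 2 along `u`, so the determinant term grows by `r log 2`. Fewer than `r / 2`
  -- far points gain at most `log 2` each, and every point at most a further `3δ²/2`, in total at
  -- most `r log 2 / 4`. Hence the energy would fall below its infimum.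
  set S := LinearMap.transvection (innerₗ (EuclideanSpace ℝ (Fin n)) u) u with hS
  have hSdet : S.det = 2 := by
    rw [hS, LinearMap.transvection.det, innerₗ_apply_apply, real_inner_self_eq_norm_sq, hu]; norm_num
  have hSTdet : (S ∘ₗ T).det = 2 * T.det := by rw [LinearMap.det_comp, hSdet]
  have hST : (S ∘ₗ T).det ≠ 0 := by rw [hSTdet]; exact mul_ne_zero two_ne_zero hT
  have hle : sInf (Φ '' {T | T.det ≠ 0}) ≤ Φ (S ∘ₗ T) := csInf_le hbdd ⟨_, hST, rfl⟩
  have hnorm : ∀ y, ‖S y‖ ^ 2 = ‖y‖ ^ 2 + 3 * (inner ℝ u y) ^ 2 := by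
    intro y
    rw [hS, LinearMap.transvection.apply, innerₗ_apply_apply, norm_add_sq_real, norm_smul, hu,
      inner_smul_right, real_inner_comm, mul_one, Real.norm_eq_abs, sq_abs]
    ring
  have hTinj : Function.Injective T :=
    ((LinearMap.isUnit_iff_isUnit_det T).2 (Ne.isUnit hT) |> (Module.End.isUnit_iff T).1).1
  have hTx : ∀ x ∈ Y, 0 < ‖T x‖ := by
    intro x hx
    rw [norm_pos_iff]
    intro h
    exact hY0 (by rwa [← hTinj (a₁ := x) (a₂ := 0) (by simpa using h)])
  have hbound : ∀ x ∈ Y, Real.log ‖(S ∘ₗ T) x‖ ≤ Real.log ‖T x‖ + 3 / 2 * δ ^ 2 +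
      if δ * ‖T x‖ ≤ |inner ℝ u (T x)| then Real.log 2 else 0 := by
    intro x hx
    have h0 := hTx x hx
    have h1 := hnorm (T x)
    have hpos : 0 < ‖S (T x)‖ ^ 2 := by rw [h1]; positivity
    have h2 : Real.log (‖S (T x)‖ ^ 2) = 2 * Real.log ‖S (T x)‖ := by
      rw [Real.log_pow]; norm_num
    have h3 : Real.log (‖T x‖ ^ 2) = 2 * Real.log ‖T x‖ := by
      rw [Real.log_pow]; norm_num
    rw [LinearMap.comp_apply]
    split_ifs with hc
    · have hcs : |inner ℝ u (T x)| ≤ ‖T x‖ := by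
        simpa [hu] using abs_real_inner_le_norm u (T x)
      have h4 : ‖S (T x)‖ ^ 2 ≤ 2 ^ 2 * ‖T x‖ ^ 2 := by
        rw [h1]
        have := sq_le_sq' (by linarith [neg_abs_le |inner ℝ u (T x)|, abs_nonneg (inner ℝ u (T x))]) hcs
        rw [sq_abs] at this
        linarith
      have h5 := Real.log_le_log hpos h4
      rw [Real.log_mul (by norm_num) (by positivity), h2, h3, Real.log_pow] at h5
      push_cast at h5
      nlinarith [sq_nonneg δ]
    · push Not at hc
      have h4 : ‖S (T x)‖ ^ 2 ≤ (1 + 3 * δ ^ 2) * ‖T x‖ ^ 2 := by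
        rw [h1]
        have := sq_le_sq' (by linarith [abs_nonneg (inner ℝ u (T x))]) hc.le
        rw [sq_abs] at this
        nlinarith
      have h5 := Real.log_le_log hpos h4
      rw [Real.log_mul (by positivity) (by positivity), h2, h3] at h5
      have h6 := Real.log_le_sub_one_of_pos (show 0 < 1 + 3 * δ ^ 2 by positivity)
      linarith
  have hsum := Finset.sum_le_sum hbound
  rw [Finset.sum_add_distrib, Finset.sum_add_distrib, Finset.sum_const, ← Finset.sum_filter,
    Finset.sum_const, nsmul_eq_mul, nsmul_eq_mul] at hsum
  have hlogdet : Real.log |(S ∘ₗ T).det| = Real.log 2 + Real.log |T.det| := by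
    rw [hSTdet, abs_mul, Real.log_mul (by norm_num) (abs_pos.2 hT).ne']; norm_num
  have hYr : (Y.card : ℝ) = r * n := by exact_mod_cast hYc
  have hcon' : ((Y.filter fun x => δ * ‖T x‖ ≤ |inner ℝ u (T x)|).card : ℝ) ≤ r / 2 := by
    refine hcon.le.trans (le_of_eq ?_)
    rw [hYr]; field_simp
  have hδ' : (Y.card : ℝ) * (3 / 2 * δ ^ 2) ≤ r * Real.log 2 / 4 := by
    rw [hYr]; nlinarith
  have hlast := mul_le_mul_of_nonneg_right hcon' (by linarith : (0 : ℝ) ≤ Real.log 2)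
  simp only [hΦ, hlogdet] at hle hTlt
  nlinarith

/-! ### Sign witnesses for linear functionals. -/

/-- The signs of a unit functional on a suitable finite set determine it up to `δ`. -/
theorem exists_finset_dist_lt_of_sign_eq (n : ℕ) {δ : ℝ} (hδ : 0 < δ) :
    ∃ F : Finset (EuclideanSpace ℝ (Fin n)), ∀ u v : EuclideanSpace ℝ (Fin n), ‖u‖ = 1 → ‖v‖ = 1 →
      (∀ f ∈ F, SignType.sign (inner ℝ u f) = SignType.sign (inner ℝ v f)) → ‖u - v‖ < δ := by
  classical
  -- Distinct unit vectors `u`, `v` are strictly separated by the test vector `u - v`, an open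
  -- condition, and the pairs at distance at least `δ` form a compact set.
  set K : Set (EuclideanSpace ℝ (Fin n) × EuclideanSpace ℝ (Fin n)) :=
    (Metric.sphere 0 1 ×ˢ Metric.sphere 0 1) ∩ {p | δ ≤ ‖p.1 - p.2‖} with hK
  have hKc : IsCompact K := ((isCompact_sphere _ _).prod (isCompact_sphere _ _)).inter_right
    (isClosed_le continuous_const (by fun_prop))
  obtain ⟨F, hF⟩ := hKc.elim_finite_subcover
    (fun f : EuclideanSpace ℝ (Fin n) => {p | 0 < inner ℝ p.1 f ∧ inner ℝ p.2 f < 0})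
    (fun f => by
      have h1 : IsOpen {p : EuclideanSpace ℝ (Fin n) × EuclideanSpace ℝ (Fin n) |
        0 < (inner ℝ p.1 f : ℝ)} := isOpen_lt continuous_const (by fun_prop)
      have h2 : IsOpen {p : EuclideanSpace ℝ (Fin n) × EuclideanSpace ℝ (Fin n) |
        (inner ℝ p.2 f : ℝ) < 0} := isOpen_lt (by fun_prop) continuous_const
      exact h1.inter h2) (by
      rintro ⟨u, v⟩ ⟨⟨hu, hv⟩, huv⟩
      simp only [mem_sphere_iff_norm, sub_zero, Set.mem_ofPred_eq] at hu hv huv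
      have h := norm_sub_sq_real u v
      have h1 := real_inner_self_eq_norm_sq u
      have h2 := real_inner_self_eq_norm_sq v
      rw [hu] at h h1
      rw [hv] at h h2
      have h3 : 0 < ‖u - v‖ ^ 2 := by have := hδ.trans_le huv; positivity
      refine Set.mem_iUnion.2 ⟨u - v, ?_⟩
      simp only [Set.mem_ofPred_eq, inner_sub_right, real_inner_comm u v] at *
      constructor <;> nlinarith)
  refine ⟨F, fun u v hu hv h => ?_⟩
  by_contra! hcon
  have hmem : (u, v) ∈ K := ⟨⟨by simpa using hu, by simpa using hv⟩, hcon⟩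
  obtain ⟨f, hf, hf1, hf2⟩ := Set.mem_iUnion₂.1 (hF hmem)
  have := h f hf
  rw [sign_pos hf1, sign_neg hf2] at this
  exact absurd this (by decide)

open Module in
/-- The signs of a linear functional on some set of at most `M` vectors determine its sign on a
subset of `X` of proportion at least `c`, on which it is constant. -/
def HasSignWitness {V : Type*} [AddCommGroup V] [Module ℝ V] (c : ℝ) (M : ℕ) (X : Finset V) :
    Prop :=
  ∃ F : Finset V, F.card ≤ M ∧ ∀ l : Dual ℝ V, ∃ A ⊆ X, c * X.card ≤ A.card ∧
    ∃ s : SignType, ∀ l' : Dual ℝ V,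
      (∀ f ∈ F, SignType.sign (l' f) = SignType.sign (l f)) → ∀ x ∈ A, SignType.sign (l' x) = s

theorem HasSignWitness.map {V W : Type*} [AddCommGroup V] [Module ℝ V] [AddCommGroup W]
    [Module ℝ W] {c c' : ℝ} {M M' : ℕ} {X : Finset V} {Y : Finset W} (h : HasSignWitness c M X)
    (j : V →ₗ[ℝ] W) (hj : Function.Injective j) (hXY : ∀ x ∈ X, j x ∈ Y)
    (hc : c' * Y.card ≤ c * X.card) (hM : M ≤ M') : HasSignWitness c' M' Y := by
  classical
  obtain ⟨F, hF, h⟩ := h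
  refine ⟨F.image j, Finset.card_image_le.trans (hF.trans hM), fun l => ?_⟩
  obtain ⟨A, hA, hcard, s, hs⟩ := h (l ∘ₗ j)
  refine ⟨A.image j, ?_, ?_, s, fun l' hl' y hy => ?_⟩
  · intro y hy
    obtain ⟨x, hx, rfl⟩ := Finset.mem_image.1 hy
    exact hXY x (hA hx)
  · rw [Finset.card_image_of_injective _ hj]
    exact hc.trans hcard
  · obtain ⟨x, hx, rfl⟩ := Finset.mem_image.1 hy
    exact hs (l' ∘ₗ j) (fun f hf => hl' (j f) (Finset.mem_image_of_mem j hf)) x hx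

theorem exists_inner_eq {n : ℕ} (l : Module.Dual ℝ (EuclideanSpace ℝ (Fin n))) :
    ∃ w : EuclideanSpace ℝ (Fin n), ∀ y, l y = inner ℝ w y :=
  ⟨(InnerProductSpace.toDual ℝ (EuclideanSpace ℝ (Fin n))).symm (LinearMap.toContinuousLinearMap l),
    fun y => by rw [InnerProductSpace.toDual_symm_apply]; rfl⟩

theorem sign_eq_of_abs_sub_lt {a b : ℝ} (h : |a - b| < |a|) :
    SignType.sign b = SignType.sign a := by
  rcases lt_trichotomy a 0 with ha | rfl | ha
  · rw [abs_of_neg ha, abs_lt] at h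
    rw [sign_neg ha, sign_neg (by linarith)]
  · simp at h
    exact absurd h (not_lt.2 (abs_nonneg b))
  · rw [abs_of_pos ha, abs_lt] at h
    rw [sign_pos ha, sign_pos (by linarith)]

/-- In the spread coordinates, functionals with equal signs on the test vectors have directions
within `δ` of each other, hence equal signs at all points far from the kernel. These make up a
fraction `1 / (2n)`; keeping the more frequent sign costs a factor 2. -/
theorem exists_hasSignWitness_of_spread {n : ℕ} (hn : n ≠ 0) :
    ∃ M : ℕ, ∀ (Y : Finset (EuclideanSpace ℝ (Fin n))) (r : ℕ) (C : ℝ), Y.card = r * n →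
      (0 : EuclideanSpace ℝ (Fin n)) ∉ Y →
      (∀ T : EuclideanSpace ℝ (Fin n) →ₗ[ℝ] EuclideanSpace ℝ (Fin n), T.det ≠ 0 →
        r * Real.log |T.det| + C ≤ ∑ x ∈ Y, Real.log ‖T x‖) →
      HasSignWitness (1 / (4 * n)) M Y := by
  classical
  have hn' : (1 : ℝ) ≤ n := by exact_mod_cast Nat.one_le_iff_ne_zero.2 hn
  set δ : ℝ := 1 / (12 * n) with hδ
  have hδ0 : 0 < δ := by positivity
  have hδ1 : 12 * n * δ ^ 2 ≤ 1 := by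
    rw [hδ]; field_simp; linarith
  obtain ⟨F, hF⟩ := exists_finset_dist_lt_of_sign_eq n hδ0
  set b := EuclideanSpace.basisFun (Fin n) ℝ with hb
  -- The basis vectors detect the zero functional, which has no direction to compare.
  set G := F ∪ Finset.univ.image b with hG
  refine ⟨G.card, fun Y r C hYc hY0 hYC => ?_⟩
  obtain ⟨T, hT, hspread⟩ := exists_linearMap_le_card_filter_inner hn hδ1 Y r C hYc hY0 hYC
  set e := LinearEquiv.ofBijective T
    ((LinearMap.isUnit_iff_isUnit_det T).2 (Ne.isUnit hT) |> (Module.End.isUnit_iff T).1) with he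
  have heT : ∀ x, e x = T x := fun x => rfl
  refine ⟨G.image e.symm, Finset.card_image_le, fun l => ?_⟩
  have hrep : ∀ l : Module.Dual ℝ (EuclideanSpace ℝ (Fin n)), ∃ w : EuclideanSpace ℝ (Fin n),
      ∀ x, l x = inner ℝ w (T x) := by
    intro l
    obtain ⟨w, hw⟩ := exists_inner_eq (l ∘ₗ e.symm.toLinearMap)
    exact ⟨w, fun x => by rw [← hw, ← heT]; simp⟩
  obtain ⟨w, hw⟩ := hrep l
  have hzero : ∀ w : EuclideanSpace ℝ (Fin n), (∀ g ∈ G, SignType.sign (inner ℝ w g) = 0) →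
      w = 0 := by
    intro w h
    ext i
    have := h (b i) (Finset.mem_union_right _ (Finset.mem_image_of_mem _ (Finset.mem_univ i)))
    rw [sign_eq_zero_iff, hb, EuclideanSpace.basisFun_apply] at this
    simpa [EuclideanSpace.inner_single_right] using this
  have hGl : ∀ l' : Module.Dual ℝ (EuclideanSpace ℝ (Fin n)), ∀ w', (∀ x, l' x = inner ℝ w' (T x)) →
      (∀ f ∈ G.image e.symm, SignType.sign (l' f) = SignType.sign (l f)) →
      ∀ g ∈ G, SignType.sign (inner ℝ w' g) = SignType.sign (inner ℝ w g) := by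
    intro l' w' hw' h g hg
    have := h (e.symm g) (Finset.mem_image_of_mem _ hg)
    rwa [hw, hw', ← heT, e.apply_symm_apply] at this
  by_cases hw0 : w = 0
  · refine ⟨Y, subset_rfl, ?_, 0, fun l' hl' x _ => ?_⟩
    · have : (1 : ℝ) / (4 * n) ≤ 1 := by
        rw [div_le_one (by positivity)]; linarith
      exact mul_le_of_le_one_left (by positivity) this
    · obtain ⟨w', hw'⟩ := hrep l'
      have : w' = 0 := hzero w' fun g hg => by rw [hGl l' w' hw' hl' g hg, hw0]; simp
      rw [hw', this]; simp
  set u := ‖w‖⁻¹ • w with hu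
  have hu1 : ‖u‖ = 1 := norm_smul_inv_norm (𝕜 := ℝ) hw0
  have hsgn : ∀ (w : EuclideanSpace ℝ (Fin n)), w ≠ 0 → ∀ y,
      SignType.sign (inner ℝ (‖w‖⁻¹ • w) y : ℝ) = SignType.sign (inner ℝ w y) := by
    intro w hw y
    rw [real_inner_smul_left, sign_mul, sign_pos (by positivity : 0 < ‖w‖⁻¹), one_mul]
  set S := Y.filter fun x => δ * ‖T x‖ ≤ |inner ℝ u (T x)| with hS
  have hTx : ∀ x ∈ Y, 0 < ‖T x‖ := by
    intro x hx
    rw [norm_pos_iff, ← heT, Ne, LinearEquiv.map_eq_zero_iff]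
    rintro rfl
    exact hY0 hx
  have hmain : ∀ l' : Module.Dual ℝ (EuclideanSpace ℝ (Fin n)),
      (∀ f ∈ G.image e.symm, SignType.sign (l' f) = SignType.sign (l f)) →
      ∀ x ∈ S, SignType.sign (l' x) = SignType.sign (l x) := by
    intro l' hl' x hx
    obtain ⟨w', hw'⟩ := hrep l'
    have hg := hGl l' w' hw' hl'
    have hw'0 : w' ≠ 0 := by
      rintro rfl
      exact hw0 (hzero w fun g hg' => by rw [← hg g hg']; simp)
    have hlt := hF u (‖w'‖⁻¹ • w') hu1 (norm_smul_inv_norm (𝕜 := ℝ) hw'0) fun f hf => by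
      rw [hu, hsgn w hw0, hsgn w' hw'0, hg f (Finset.mem_union_left _ hf)]
    rw [hS, Finset.mem_filter] at hx
    rw [hw, hw', ← hsgn w hw0, ← hsgn w' hw'0]
    refine sign_eq_of_abs_sub_lt (lt_of_lt_of_le ?_ hx.2)
    rw [← inner_sub_left]
    exact (abs_real_inner_le_norm _ _).trans_lt (mul_lt_mul_of_pos_right hlt (hTx x hx.1))
  have hne : ∀ x ∈ S, l x ≠ 0 := by
    intro x hx h
    rw [hS, Finset.mem_filter] at hx
    have h1 := hsgn w hw0 (T x)
    rw [← hw, h, sign_zero, sign_eq_zero_iff] at h1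
    rw [h1, abs_zero] at hx
    exact absurd hx.2 (not_le.2 (mul_pos hδ0 (hTx x hx.1)))
  have hcard : (S.card : ℝ) = (S.filter fun x => 0 < l x).card + (S.filter fun x => ¬ 0 < l x).card := by
    exact_mod_cast (Finset.card_filter_add_card_filter_not _).symm
  have hSc := hspread u hu1
  have hY4 : (1 : ℝ) / (4 * n) * Y.card = (Y.card / (2 * n)) / 2 := by
    generalize (Y.card : ℝ) = y
    clear_value δ
    field_simp
    ring
  rw [hY4]
  by_cases hpos : (Y.card : ℝ) / (2 * n) / 2 ≤ (S.filter fun x => 0 < l x).card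
  · refine ⟨_, (Finset.filter_subset _ _).trans (Finset.filter_subset _ _), hpos, 1,
      fun l' hl' x hx => ?_⟩
    rw [Finset.mem_filter] at hx
    rw [hmain l' hl' x hx.1, sign_pos hx.2]
  · refine ⟨S.filter fun x => ¬ 0 < l x, (Finset.filter_subset _ _).trans (Finset.filter_subset _ _),
      by linarith, -1, fun l' hl' x hx => ?_⟩
    rw [Finset.mem_filter] at hx
    rw [hmain l' hl' x hx.1, sign_neg (lt_of_le_of_ne (not_lt.1 hx.2) (hne x hx.1))]

open Module in
/-- The signs of a linear functional on boundedly many vectors determine its sign on a positive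
proportion of any given finite set. -/
theorem exists_hasSignWitness (n : ℕ) :
    ∃ c : ℝ, 0 < c ∧ ∃ M : ℕ, ∀ (V : Type) [AddCommGroup V] [Module ℝ V] [FiniteDimensional ℝ V],
      finrank ℝ V ≤ n → ∀ X : Finset V, HasSignWitness c M X := by
  classical
  induction n with
  | zero =>
    refine ⟨1, one_pos, 0, fun V _ _ _ hV X => ⟨∅, by simp, fun l => ⟨X, subset_rfl, by simp, 0,
      fun l' _ x _ => ?_⟩⟩⟩
    have := finrank_zero_iff.1 (Nat.le_zero.1 hV)
    rw [Subsingleton.elim x 0]; simp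
  | succ n ih =>
    obtain ⟨c, hc, M, ih⟩ := ih
    obtain ⟨M', hM'⟩ := exists_hasSignWitness_of_spread (Nat.succ_ne_zero n)
    refine ⟨min (c / 2) (1 / (4 * (n + 1 : ℕ)) / 2), by positivity, max M M', fun V _ _ _ hV X => ?_⟩
    rcases Nat.lt_or_ge (finrank ℝ V) (n + 1) with hlt | hge
    · refine (ih V (by omega) X).map LinearMap.id Function.injective_id (fun x hx => hx)
        (mul_le_mul_of_nonneg_right ?_ (Nat.cast_nonneg _)) (le_max_left _ _)
      exact (min_le_left _ _).trans (by linarith)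
    · have e : V ≃ₗ[ℝ] EuclideanSpace ℝ (Fin (n + 1)) :=
        LinearEquiv.ofFinrankEq _ _ (by rw [finrank_euclideanSpace_fin]; omega)
      obtain ⟨Y, hYX, r, C, hYc, hY0, hYs, hYC⟩ :=
        exists_subset_log_det_le_sum_log_norm (Nat.succ_ne_zero n) (X.image e)
      have hXc : (X.image e).card = X.card := Finset.card_image_of_injective _ e.injective
      have hmem : ∀ y ∈ X.image e, e.symm y ∈ X := by
        intro y hy
        obtain ⟨x, hx, rfl⟩ := Finset.mem_image.1 hy
        simpa using hx
      have hsplit : ((X.image e \ Y).card : ℝ) + Y.card = X.card := by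
        rw [← hXc]; exact_mod_cast Finset.card_sdiff_add_card_eq_card hYX
      -- Either the union of bases `Y` holds half of the points and can be spread out, or half of
      -- them lie in a proper subspace, where induction on the dimension applies.
      by_cases hbig : (X.card : ℝ) / 2 ≤ Y.card
      · refine (hM' Y r C hYc hY0 hYC).map (e.symm : _ →ₗ[ℝ] V) e.symm.injective
          (fun y hy => hmem y (hYX hy)) ?_ (le_max_right _ _)
        refine (mul_le_mul_of_nonneg_right (min_le_right _ _) (Nat.cast_nonneg _)).trans ?_
        rw [div_mul_eq_mul_div, mul_div_assoc]
        exact mul_le_mul_of_nonneg_left hbig (by positivity)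
      · set W := Submodule.span ℝ ((X.image e : Set (EuclideanSpace ℝ (Fin (n + 1)))) \ Y) with hW
        have hWn : finrank ℝ W ≤ n := by
          have := Submodule.finrank_lt hYs
          rw [finrank_euclideanSpace_fin] at this
          omega
        set Z : Finset W := (X.image e \ Y).subtype (· ∈ W) with hZ
        have hZc : Z.card = (X.image e \ Y).card := by
          rw [hZ, Finset.card_subtype, Finset.filter_true_of_mem]
          intro x hx
          refine Submodule.subset_span ?_
          simpa using hx
        refine (ih W hWn Z).map ((e.symm : _ →ₗ[ℝ] V) ∘ₗ W.subtype)
          (e.symm.injective.comp W.injective_subtype) (fun z hz => ?_) ?_ (le_max_left _ _)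
        · have := Finset.mem_subtype.1 hz
          exact hmem _ (Finset.mem_sdiff.1 this).1
        · refine (mul_le_mul_of_nonneg_right (min_le_left _ _) (Nat.cast_nonneg _)).trans ?_
          rw [div_mul_eq_mul_div, mul_div_assoc, hZc]
          exact mul_le_mul_of_nonneg_left (by linarith) hc.le

/-! ### Boxes on which a separately affine function has constant sign. -/

section

open Module Function

/-- Successive refinement: if each of finitely many hereditary properties of boxes can be achieved
by passing to subsets of proportion `c`, then all of them can be achieved simultaneously. -/
theorem exists_subsets_forall_of_forall_exists_subsets {ι V κ : Type*} {c : ℝ} (hc : 0 < c)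
    (p : κ → (ι → Finset V) → Prop) (hp : ∀ k X Y, (∀ i, Y i ⊆ X i) → p k X → p k Y)
    (S : Finset κ)
    (h : ∀ k ∈ S, ∀ X : ι → Finset V, (∀ i, (X i).Nonempty) →
      ∃ Y : ι → Finset V, (∀ i, Y i ⊆ X i) ∧ (∀ i, c * (X i).card ≤ (Y i).card) ∧ p k Y)
    (X : ι → Finset V) (hX : ∀ i, (X i).Nonempty) :
    ∃ Y : ι → Finset V, (∀ i, Y i ⊆ X i) ∧ (∀ i, c ^ S.card * (X i).card ≤ (Y i).card) ∧
      ∀ k ∈ S, p k Y := by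
  classical
  induction S using Finset.induction_on with
  | empty => exact ⟨X, fun i => subset_rfl, by simp, by simp⟩
  | insert k S hk ih =>
    obtain ⟨Y, hYX, hYc, hYp⟩ := ih fun k hk => h k (Finset.mem_insert_of_mem hk)
    have hY : ∀ i, (Y i).Nonempty := by
      intro i
      have h1 : 0 < c ^ S.card * ((X i).card : ℝ) :=
        mul_pos (pow_pos hc _) (by exact_mod_cast (hX i).card_pos)
      exact Finset.card_pos.1 (by exact_mod_cast h1.trans_le (hYc i))
    obtain ⟨Z, hZY, hZc, hZp⟩ := h k (Finset.mem_insert_self _ _) Y hY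
    refine ⟨Z, fun i => (hZY i).trans (hYX i), fun i => ?_, fun k' hk' => ?_⟩
    · rw [Finset.card_insert_of_notMem hk, pow_succ', mul_assoc]
      exact (mul_le_mul_of_nonneg_left (hYc i) hc.le).trans (hZc i)
    · rcases Finset.mem_insert.1 hk' with rfl | hk'
      · exact hZp
      · exact hp k' Y Z hZY (hYp k' hk')

/-- A function of several vectors which is affine in each of them. -/
def IsSeparatelyAffine {ι V : Type*} [DecidableEq ι] [AddCommGroup V] [Module ℝ V]
    (f : (ι → V) → ℝ) : Prop :=
  ∀ i v, ∃ (l : Dual ℝ V) (a : ℝ), ∀ x, f (update v i x) = l x + a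

namespace IsSeparatelyAffine

variable {ι V : Type*} [DecidableEq ι] [AddCommGroup V] [Module ℝ V] {f g : (ι → V) → ℝ}

theorem add (hf : IsSeparatelyAffine f) (hg : IsSeparatelyAffine g) :
    IsSeparatelyAffine fun v => f v + g v := by
  intro i v
  obtain ⟨l, a, h⟩ := hf i v
  obtain ⟨l', a', h'⟩ := hg i v
  exact ⟨l + l', a + a', fun x => by beta_reduce; rw [h, h', LinearMap.add_apply]; ring⟩

theorem const_mul (hf : IsSeparatelyAffine f) (s : ℝ) :
    IsSeparatelyAffine fun v => s * f v := by
  intro i v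
  obtain ⟨l, a, h⟩ := hf i v
  exact ⟨s • l, s * a, fun x => by beta_reduce; rw [h, LinearMap.smul_apply, smul_eq_mul]; ring⟩

theorem comp_update (hf : IsSeparatelyAffine f) (i : ι) (u : V) :
    IsSeparatelyAffine fun v => f (update v i u) := by
  intro j v
  by_cases hij : j = i
  · subst hij
    exact ⟨0, f (update v j u), fun x => by simp⟩
  · obtain ⟨l, a, h⟩ := hf j (update v i u)
    exact ⟨l, a, fun x => by beta_reduce; rw [← h, update_comm hij]⟩

end IsSeparatelyAffine

/-- A separately affine function has constant sign on a box of positive proportion. -/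
theorem exists_subsets_sign_eq {ι V : Type} [DecidableEq ι] [AddCommGroup V] [Module ℝ V]
    [FiniteDimensional ℝ V] (J : Finset ι) :
    ∃ c : ℝ, 0 < c ∧ ∀ f : (ι → V) → ℝ, IsSeparatelyAffine f →
      (∀ v w, (∀ i ∈ J, v i = w i) → f v = f w) →
      ∀ X : ι → Finset V, (∀ i, (X i).Nonempty) →
        ∃ Y : ι → Finset V, (∀ i, Y i ⊆ X i) ∧ (∀ i, c * (X i).card ≤ (Y i).card) ∧
          ∃ s : SignType, ∀ v, (∀ i, v i ∈ Y i) → SignType.sign (f v) = s := by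
  classical
  induction J using Finset.induction_on with
  | empty =>
    refine ⟨1, one_pos, fun f _ hJ X _ => ⟨X, fun i => subset_rfl, by simp,
      SignType.sign (f 0), fun v _ => ?_⟩⟩
    rw [hJ v 0 (by simp)]
  | insert i J hi ih =>
    obtain ⟨c, hc, ih⟩ := ih
    obtain ⟨c', hc', M, hM⟩ := exists_hasSignWitness (finrank ℝ (V × ℝ))
    refine ⟨min c' (min c 1 ^ M), by positivity, fun f hf hJ X hX => ?_⟩
    have hinj : Injective fun x : V => (x, (1 : ℝ)) := fun x y h => congrArg Prod.fst h
    obtain ⟨F, hFM, hF⟩ := hM (V × ℝ) le_rfl ((X i).image fun x => (x, (1 : ℝ)))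
    -- Homogenisation in the variable `i`: if `f (update v i x) = l x + a`, then `g p v = l p.1 +
    -- p.2 * a`, which is linear in `p` and equals `f (update v i x)` at `p = (x, 1)`.
    set g : V × ℝ → (ι → V) → ℝ :=
      fun p v => f (update v i p.1) + (p.2 + -1) * f (update v i 0) with hg
    have hL : ∀ v, ∃ L : Dual ℝ (V × ℝ), ∀ p, g p v = L p := by
      intro v
      obtain ⟨l, a, h⟩ := hf i v
      refine ⟨l ∘ₗ LinearMap.fst ℝ V ℝ + a • LinearMap.snd ℝ V ℝ, fun p => ?_⟩
      simp only [hg, h, LinearMap.add_apply, LinearMap.comp_apply, LinearMap.fst_apply,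
        LinearMap.smul_apply, LinearMap.snd_apply, smul_eq_mul, map_zero]
      ring
    -- For each test vector `p ∈ F`, `g p` depends only on the variables in `J`, so induction
    -- freezes its sign. On the resulting box all functionals `g · v` have the same signs on `F`.
    obtain ⟨Y, hYX, hYc, hYp⟩ := exists_subsets_forall_of_forall_exists_subsets
      (κ := V × ℝ) (lt_min hc one_pos)
      (fun p Y => ∃ s : SignType, ∀ v, (∀ i, v i ∈ Y i) → SignType.sign (g p v) = s)
      (fun p X Y hYX ⟨s, hs⟩ => ⟨s, fun v hv => hs v fun i => hYX i (hv i)⟩) F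
      (fun p _ X hX => by
        obtain ⟨Y, hYX, hYc, hY⟩ := ih (g p)
          ((hf.comp_update i p.1).add ((hf.comp_update i 0).const_mul _))
          (fun v w hvw => by
            have : ∀ u, f (update v i u) = f (update w i u) := fun u => hJ _ _ fun j hj => by
              rcases Finset.mem_insert.1 hj with rfl | hj
              · simp
              · have hji : j ≠ i := ne_of_mem_of_not_mem hj hi
                rw [update_of_ne hji, update_of_ne hji, hvw j hj]
            simp only [hg, this]) X hX
        exact ⟨Y, hYX, fun i => (mul_le_mul_of_nonneg_right (min_le_left _ _)
          (Nat.cast_nonneg _)).trans (hYc i), hY⟩) X hX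
    have hY : ∀ j, (Y j).Nonempty := by
      intro j
      have h1 : 0 < min c 1 ^ F.card * ((X j).card : ℝ) :=
        mul_pos (by positivity) (by exact_mod_cast (hX j).card_pos)
      exact Finset.card_pos.1 (by exact_mod_cast h1.trans_le (hYc j))
    choose v₀ hv₀ using hY
    obtain ⟨L₀, hL₀⟩ := hL v₀
    obtain ⟨A, hAX, hAc, s, hs⟩ := hF L₀
    set B := (X i).filter fun x => (x, (1 : ℝ)) ∈ A with hB
    have hBA : B.card = A.card := by
      have : A = B.image fun x => (x, (1 : ℝ)) := by
        ext p
        simp only [hB, Finset.mem_image, Finset.mem_filter]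
        constructor
        · intro hp
          obtain ⟨x, hx, rfl⟩ := Finset.mem_image.1 (hAX hp)
          exact ⟨x, ⟨hx, hp⟩, rfl⟩
        · rintro ⟨x, ⟨-, hx⟩, rfl⟩
          exact hx
      rw [this, Finset.card_image_of_injective _ hinj]
    -- `B` is cut from `X i` and need not lie in `Y i`; this is harmless because `g p` ignores the
    -- coordinate `i`.
    refine ⟨update Y i B, fun j => ?_, fun j => ?_, s, fun v hv => ?_⟩
    · rcases eq_or_ne j i with rfl | hj
      · rw [update_self]; exact Finset.filter_subset _ _
      · rw [update_of_ne hj]; exact hYX j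
    · rcases eq_or_ne j i with rfl | hj
      · rw [update_self, hBA]
        rw [Finset.card_image_of_injective _ hinj] at hAc
        exact (mul_le_mul_of_nonneg_right (min_le_left _ _) (Nat.cast_nonneg _)).trans hAc
      · rw [update_of_ne hj]
        refine (mul_le_mul_of_nonneg_right ((min_le_right _ _).trans ?_)
          (Nat.cast_nonneg _)).trans (hYc j)
        exact pow_le_pow_of_le_one (by positivity) (min_le_right _ _) hFM
    · set v' := update v i (v₀ i) with hv'
      have hv'Y : ∀ j, v' j ∈ Y j := by
        intro j
        rcases eq_or_ne j i with rfl | hj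
        · rw [hv', update_self]; exact hv₀ j
        · rw [hv', update_of_ne hj]
          have := hv j
          rwa [update_of_ne hj] at this
      obtain ⟨L, hL⟩ := hL v'
      have hvi := hv i
      rw [update_self, hB, Finset.mem_filter] at hvi
      have h1 := hs L (fun p hp => by
        obtain ⟨t, ht⟩ := hYp p hp
        rw [← hL, ← hL₀, ht v' hv'Y, ht v₀ hv₀]) _ hvi.2
      rw [← h1, ← hL]
      simp [hg, hv']

end

/-! ### Determinant signs, convex hulls and homogeneous boxes. -/

section

open Module Function

/-- The determinants, in coordinates of a basis `b`, of the families formed from the vectors `v i`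
and from basis vectors. -/
noncomputable def mixedDet {d : ℕ} {κ : Type*} {V : Type*} [AddCommGroup V] [Module ℝ V]
    (b : Basis (Fin d) ℝ V) (φ : Fin d → κ ⊕ Fin d) (v : κ → V) : ℝ :=
  b.det fun k => Sum.elim v b (φ k)

/-- Injectivity of `φ` places each `v i` in at most one slot of the determinant; a repeated slot
would make the dependence quadratic or worse. -/
theorem isSeparatelyAffine_mixedDet_sub {d : ℕ} {κ V : Type*} [DecidableEq κ]
    [AddCommGroup V] [Module ℝ V] (b : Basis (Fin d) ℝ V) {φ : Fin d → κ ⊕ Fin d}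
    (hφ : Injective φ) (q : V) :
    IsSeparatelyAffine fun v : κ → V => mixedDet b φ fun i => v i - q := by
  classical
  intro i v
  by_cases h : ∃ k, φ k = Sum.inl i
  · obtain ⟨k, hk⟩ := h
    set m : Fin d → V := fun k => Sum.elim (fun i => v i - q) b (φ k) with hm
    set L := b.det.toMultilinearMap.toLinearMap m k with hL
    refine ⟨L, -L q, fun x => ?_⟩
    rw [← sub_eq_add_neg, ← map_sub, hL, MultilinearMap.toLinearMap_apply]
    change b.det _ = b.det _
    congr 1
    ext1 k'
    rcases eq_or_ne k' k with rfl | hk'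
    · simp [hk]
    · rw [update_of_ne hk', hm]
      rcases hj : φ k' with j | j
      · have : j ≠ i := by
          rintro rfl
          exact hk' (hφ (hj.trans hk.symm))
        simp [this, hj]
      · simp [hj]
  · push Not at h
    refine ⟨0, mixedDet b φ fun i => v i - q, fun x => ?_⟩
    rw [LinearMap.zero_apply, zero_add]
    refine congrArg b.det (funext fun k => ?_)
    rcases hj : φ k with j | j
    · have : j ≠ i := by
        rintro rfl
        exact h k hj
      simp [this]
    · simp

/-- Subtracting a multiple of the relation `c` from a linear relation `f` makes its total weight
zero. Affine independence then kills it; the coefficient at `j` shows that the multiple was zero. -/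
theorem linearIndepOn_erase_of_affineIndependent {ι V : Type*} [Fintype ι] [DecidableEq ι]
    [AddCommGroup V] [Module ℝ V] {y : ι → V} {c : ι → ℝ} (hy : AffineIndependent ℝ y)
    (hc : ∀ i, 0 < c i) (hc1 : ∑ i, c i = 1) (hc0 : ∑ i, c i • y i = 0) (j : ι) :
    LinearIndepOn ℝ y (Finset.univ.erase j : Finset ι) := by
  rw [linearIndepOn_finset_iff]
  intro f hf
  set s := ∑ i ∈ Finset.univ.erase j, f i with hs
  set μ : ι → ℝ := fun i => (if i = j then 0 else f i) - s * c i with hμ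
  have hif : ∑ i, (if i = j then 0 else f i) = s := by
    rw [← Finset.add_sum_erase _ _ (Finset.mem_univ j), if_pos rfl, zero_add, hs]
    exact Finset.sum_congr rfl fun i hi => if_neg (Finset.ne_of_mem_erase hi)
  have hif' : ∑ i, (if i = j then 0 else f i) • y i = 0 := by
    rw [← Finset.add_sum_erase _ _ (Finset.mem_univ j), if_pos rfl, zero_smul, zero_add, ← hf]
    exact Finset.sum_congr rfl fun i hi => by rw [if_neg (Finset.ne_of_mem_erase hi)]
  have h1 : ∑ i, μ i = 0 := by
    simp only [hμ, Finset.sum_sub_distrib, ← Finset.mul_sum, hc1, hif]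
    ring
  have h2 : ∑ i, μ i • y i = 0 := by
    simp only [hμ, sub_smul, Finset.sum_sub_distrib, hif', mul_smul, ← Finset.smul_sum, hc0]
    simp
  have h3 := affineIndependent_iff.1 hy Finset.univ μ h1 h2
  have hs0 : s = 0 := by
    have := h3 j (Finset.mem_univ j)
    simp only [hμ, if_true, zero_sub, neg_eq_zero, mul_eq_zero] at this
    exact this.resolve_right (hc j).ne'
  intro i hi
  have := h3 i (Finset.mem_univ i)
  simpa [hμ, hs0, Finset.ne_of_mem_erase hi] using this

/-- The signs of the mixed determinants determine whether the convex hull contains the origin. -/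
theorem zero_mem_convexHull_of_sign_mixedDet_eq {d : ℕ} {κ V : Type*} [AddCommGroup V]
    [Module ℝ V] (b : Basis (Fin d) ℝ V) {z w : κ → V}
    (h : ∀ φ : Fin d → κ ⊕ Fin d, Injective φ →
      SignType.sign (mixedDet b φ z) = SignType.sign (mixedDet b φ w))
    (hz : (0 : V) ∈ convexHull ℝ (Set.range z)) : (0 : V) ∈ convexHull ℝ (Set.range w) := by
  classical
  -- By Carathéodory, the origin is a positive combination of affinely independent vectors. All but
  -- one, `z (σ j)`, are completed by vectors of `b` to a basis, which covers degenerate simplices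
  -- too. In it `z (σ j)` has nonpositive coordinates, vanishing on the added vectors; by Cramer's
  -- rule the determinant signs transfer this to `w`.
  obtain ⟨ι, _, y, c, hyz, hy, hc, hc1, hc0⟩ := eq_pos_convex_span_of_mem_convexHull hz
  have hσ : ∀ a, ∃ i, z i = y a := fun a => hyz ⟨a, rfl⟩
  choose σ hσ using hσ
  have hσi : Injective σ := fun a a' h => hy.injective (by rw [← hσ, ← hσ, h])
  have hne : Nonempty ι := by
    by_contra hne
    rw [not_nonempty_iff] at hne
    simp at hc1
  obtain ⟨j⟩ := hne
  have hli := linearIndepOn_erase_of_affineIndependent hy hc hc1 hc0 j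
  set g : κ ⊕ Fin d → V := Sum.elim z b with hg
  set S₀ : Set (κ ⊕ Fin d) := (fun a => Sum.inl (σ a)) '' (Finset.univ.erase j : Finset ι) with hS₀
  have hli₀ : LinearIndepOn ℝ g S₀ := by
    refine LinearIndepOn.image_of_comp (fun a => Sum.inl (σ a)) g ?_
    have : g ∘ (fun a => Sum.inl (σ a)) = y := funext hσ
    rwa [this]
  obtain ⟨S, hST, hS₀S, hspan, hSli⟩ := exists_linearIndepOn_extension hli₀
    (Set.subset_union_left (t := Set.range Sum.inr))
  have hStop : ⊤ ≤ Submodule.span ℝ (g '' S) := by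
    rw [← b.span_eq, Submodule.span_le]
    rintro _ ⟨k, rfl⟩
    exact hspan ⟨Sum.inr k, Or.inr ⟨k, rfl⟩, rfl⟩
  have := Module.Finite.of_basis b
  let βS : Basis S ℝ V := Basis.mk hSli (by rwa [Set.image_eq_range] at hStop)
  let e : Fin d ≃ S := b.indexEquiv βS
  set φ : Fin d → κ ⊕ Fin d := fun k => (e k : κ ⊕ Fin d) with hφ
  have hφi : Injective φ := Subtype.val_injective.comp e.injective
  have hφS : ∀ x ∈ S, ∃ k, φ k = x := fun x hx => ⟨e.symm ⟨x, hx⟩, by simp [hφ]⟩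
  have hjS : Sum.inl (σ j) ∉ S := by
    intro hmem
    rcases hST hmem with ⟨a, ha, h'⟩ | ⟨k, hk⟩
    · have := hσi (Sum.inl_injective h')
      exact Finset.ne_of_mem_erase (Finset.mem_coe.1 ha) this
    · simp at hk
  have hli : LinearIndependent ℝ (g ∘ φ) := hSli.comp e e.injective
  have hsp : ⊤ ≤ Submodule.span ℝ (Set.range (g ∘ φ)) := by
    have : Set.range (g ∘ φ) = g '' S := by
      rw [Set.range_comp]
      congr 1
      ext x
      exact ⟨fun ⟨k, hk⟩ => hk ▸ (e k).2, hφS x⟩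
    rwa [this]
  have hD : mixedDet b φ z ≠ 0 := ((b.is_basis_iff_det (v := g ∘ φ)).1 ⟨hli, top_le_iff.1 hsp⟩).ne_zero
  have hD' : mixedDet b φ w ≠ 0 := by
    intro h0
    have := h φ hφi
    rw [h0, sign_zero, sign_eq_zero_iff] at this
    exact hD this
  obtain ⟨hli', hsp'⟩ := (b.is_basis_iff_det (v := fun k => Sum.elim w b (φ k))).2 hD'.isUnit
  set β := Basis.mk hli hsp with hβ
  set β' := Basis.mk hli' hsp'.ge with hβ'
  -- Cramer's rule for the coordinates of `z (σ j)` and `w (σ j)`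
  have hcr : ∀ k, mixedDet b φ z * β.coord k (z (σ j)) =
      mixedDet b (update φ k (Sum.inl (σ j))) z := by
    intro k
    have := LinearMap.congr_fun (b.det_smul_mk_coord_eq_det_update hli hsp k) (z (σ j))
    rw [LinearMap.smul_apply, smul_eq_mul, MultilinearMap.toLinearMap_apply] at this
    refine this.trans (congrArg b.det (funext fun k' => ?_))
    rcases eq_or_ne k' k with rfl | hk
    · simp
    · simp [update_of_ne hk, hg]
  have hcr' : ∀ k, mixedDet b φ w * β'.coord k (w (σ j)) =
      mixedDet b (update φ k (Sum.inl (σ j))) w := by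
    intro k
    have := LinearMap.congr_fun (b.det_smul_mk_coord_eq_det_update hli' hsp'.ge k) (w (σ j))
    rw [LinearMap.smul_apply, smul_eq_mul, MultilinearMap.toLinearMap_apply] at this
    refine this.trans (congrArg b.det (funext fun k' => ?_))
    rcases eq_or_ne k' k with rfl | hk
    · simp
    · simp [update_of_ne hk]
  have hsign : ∀ k, SignType.sign (β'.coord k (w (σ j))) = SignType.sign (β.coord k (z (σ j))) := by
    intro k
    have hinj : Injective (update φ k (Sum.inl (σ j))) := by
      intro a a' haa
      have hne : ∀ a, φ a ≠ Sum.inl (σ j) := fun a ha => hjS (ha ▸ (e a).2)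
      by_cases ha : a = k <;> by_cases ha' : a' = k
      · exact ha.trans ha'.symm
      · rw [ha, update_self, update_of_ne ha'] at haa
        exact absurd haa.symm (hne a')
      · rw [ha', update_self, update_of_ne ha] at haa
        exact absurd haa (hne a)
      · rw [update_of_ne ha, update_of_ne ha'] at haa
        exact hφi haa
    have h1 := h _ hinj
    rw [← hcr, ← hcr', sign_mul, sign_mul, h φ hφi] at h1
    refine (mul_left_cancel₀ ?_ h1).symm
    rwa [Ne, sign_eq_zero_iff]
  have hβa : ∀ a, a ≠ j → ∃ k, φ k = Sum.inl (σ a) ∧ z (σ a) = β k := by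
    intro a ha
    obtain ⟨k, hk⟩ := hφS (Sum.inl (σ a)) (hS₀S ⟨a, by simpa using ha, rfl⟩)
    exact ⟨k, hk, by rw [hβ, Basis.mk_apply, comp_apply, hk, hg, Sum.elim_inl]⟩
  have hlin : ∀ k, c j * β.coord k (z (σ j)) +
      ∑ a ∈ Finset.univ.erase j, c a * β.coord k (z (σ a)) = 0 := by
    intro k
    have := congrArg (β.coord k) hc0
    rw [map_sum, map_zero, ← Finset.add_sum_erase _ _ (Finset.mem_univ j)] at this
    simpa only [map_smul, smul_eq_mul, ← hσ] using this
  have hnonneg : ∀ k, ∀ a ∈ Finset.univ.erase j, 0 ≤ c a * β.coord k (z (σ a)) := by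
    intro k a ha
    obtain ⟨k', -, hk'⟩ := hβa a (Finset.ne_of_mem_erase ha)
    rw [hk', Basis.coord_apply, Basis.repr_self, Finsupp.single_apply]
    split_ifs <;> simp [(hc a).le]
  have hcoord : ∀ k, β.coord k (z (σ j)) ≤ 0 := by
    intro k
    have h1 := hlin k
    have h2 := Finset.sum_nonneg (hnonneg k)
    have h3 := hc j
    by_contra! h4
    nlinarith [mul_pos h3 h4]
  have hcoord0 : ∀ k m, φ k = Sum.inr m → β.coord k (z (σ j)) = 0 := by
    intro k m hkm
    have h1 := hlin k
    rw [Finset.sum_eq_zero, add_zero, mul_eq_zero] at h1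
    · exact h1.resolve_left (hc j).ne'
    · intro a ha
      obtain ⟨k', hk1, hk'⟩ := hβa a (Finset.ne_of_mem_erase ha)
      have : k' ≠ k := by
        rintro rfl
        rw [hk1] at hkm
        simp at hkm
      rw [hk', Basis.coord_apply, Basis.repr_self, Finsupp.single_apply, if_neg this, mul_zero]
  have hcoord' : ∀ k, β'.coord k (w (σ j)) ≤ 0 := by
    intro k
    by_contra! hpos
    have := hsign k
    rw [sign_pos hpos] at this
    exact absurd (sign_eq_one_iff.1 this.symm) (not_lt.2 (hcoord k))
  have hcoord0' : ∀ k m, φ k = Sum.inr m → β'.coord k (w (σ j)) = 0 := by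
    intro k m hkm
    have := hsign k
    rwa [hcoord0 k m hkm, sign_zero, sign_eq_zero_iff] at this
  have hrepr : ∑ k, β'.coord k (w (σ j)) • Sum.elim w b (φ k) = w (σ j) := by
    have := β'.sum_repr (w (σ j))
    simpa [hβ'] using this
  -- Slots filled from `b` have weight zero, so any point of the range of `w` may stand in for them.
  set p : Option (Fin d) → V := fun o => o.elim (w (σ j))
    fun k => (φ k).elim w fun _ => w (σ j) with hp
  set t : Option (Fin d) → ℝ := fun o => o.elim 1 fun k => -β'.coord k (w (σ j)) with ht
  have hmem := Finset.univ.centerMass_mem_convexHull (s := Set.range w) (w := t) (z := p)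
    (fun o _ => by rcases o with _ | k <;> simp [ht, -Basis.coord_apply, hcoord'])
    (by
      rw [Fintype.sum_option]
      have := Finset.sum_nonneg fun k (_ : k ∈ Finset.univ) => neg_nonneg.2 (hcoord' k)
      simp only [ht, Option.elim_none, Option.elim_some]
      linarith)
    (fun o _ => by
      rcases o with _ | k
      · exact ⟨σ j, rfl⟩
      · rcases hk : φ k with i | m
        · exact ⟨i, by simp [hp, hk]⟩
        · exact ⟨σ j, by simp [hp, hk]⟩)
  have hzero : ∑ o, t o • p o = 0 := by
    rw [Fintype.sum_option]
    have : ∀ k, t (some k) • p (some k) = -(β'.coord k (w (σ j)) • Sum.elim w b (φ k)) := by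
      intro k
      rcases hk : φ k with i | m
      · simp [ht, hp, hk]
      · have := hcoord0' k m hk
        simp only [ht, hp, Option.elim_some, this, zero_smul, neg_zero]
    simp only [this, Finset.sum_neg_distrib, hrepr]
    simp [ht, hp]
  rwa [Finset.centerMass, hzero, smul_zero] at hmem

open Pointwise in
/-- Sets of positive proportion that are homogeneous with respect to `q` exist in any `d + 1`
finite sets. -/
theorem exists_subsets_isHomogeneous (d : ℕ) :
    ∃ c : ℝ, 0 < c ∧ ∀ (q : EuclideanSpace ℝ (Fin d))
      (X : Fin (d + 1) → Finset (EuclideanSpace ℝ (Fin d))), (∀ i, (X i).Nonempty) →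
      ∃ Y : Fin (d + 1) → Finset (EuclideanSpace ℝ (Fin d)), (∀ i, Y i ⊆ X i) ∧
        (∀ i, c * (X i).card ≤ (Y i).card) ∧ IsHomogeneous q fun i => (Y i : Set _) := by
  obtain ⟨c, hc, h⟩ := exists_subsets_sign_eq (V := EuclideanSpace ℝ (Fin d))
    (Finset.univ : Finset (Fin (d + 1)))
  have b : Basis (Fin d) ℝ (EuclideanSpace ℝ (Fin d)) := (EuclideanSpace.basisFun (Fin d) ℝ).toBasis
  obtain ⟨S, hS⟩ : ∃ S : Finset (Fin d → Fin (d + 1) ⊕ Fin d), ∀ φ, φ ∈ S ↔ Injective φ :=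
    ⟨Finset.univ.filter Injective, by simp⟩
  refine ⟨c ^ S.card, pow_pos hc _, fun q X hX => ?_⟩
  let p : (Fin d → Fin (d + 1) ⊕ Fin d) → (Fin (d + 1) → Finset (EuclideanSpace ℝ (Fin d))) → Prop :=
    fun φ Y => ∃ s : SignType, ∀ v : Fin (d + 1) → EuclideanSpace ℝ (Fin d), (∀ i, v i ∈ Y i) →
      SignType.sign (mixedDet b φ fun i => v i - q) = s
  have hp : ∀ φ X Y, (∀ i, Y i ⊆ X i) → p φ X → p φ Y :=
    fun φ X Y hYX ⟨s, hs⟩ => ⟨s, fun v hv => hs v fun i => hYX i (hv i)⟩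
  have hsel : ∀ φ ∈ S, ∀ X : Fin (d + 1) → Finset (EuclideanSpace ℝ (Fin d)),
      (∀ i, (X i).Nonempty) → ∃ Y : Fin (d + 1) → Finset (EuclideanSpace ℝ (Fin d)),
        (∀ i, Y i ⊆ X i) ∧ (∀ i, c * (X i).card ≤ (Y i).card) ∧ p φ Y := by
    intro φ hφ X hX
    refine h (fun v => mixedDet b φ fun i => v i - q)
      (isSeparatelyAffine_mixedDet_sub b ((hS φ).1 hφ) q) (fun v w hvw => ?_) X hX
    rw [funext fun i => hvw i (Finset.mem_univ i)]
  obtain ⟨Y, hYX, hYc, hY⟩ := exists_subsets_forall_of_forall_exists_subsets hc p hp S hsel X hX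
  refine ⟨Y, hYX, hYc, ?_⟩
  have key : ∀ v w : Fin (d + 1) → EuclideanSpace ℝ (Fin d), (∀ i, v i ∈ Y i) → (∀ i, w i ∈ Y i) →
      q ∈ convexHull ℝ (Set.range v) → q ∈ convexHull ℝ (Set.range w) := by
    have htr : ∀ v : Fin (d + 1) → EuclideanSpace ℝ (Fin d), q ∈ convexHull ℝ (Set.range v) ↔
        0 ∈ convexHull ℝ (Set.range fun i => v i - q) := by
      intro v
      have : (Set.range fun i => v i - q) = -q +ᵥ Set.range v := by
        ext x
        simp only [Set.mem_range, Set.mem_vadd_set, vadd_eq_add]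
        constructor
        · rintro ⟨i, rfl⟩
          exact ⟨v i, ⟨i, rfl⟩, by abel⟩
        · rintro ⟨_, ⟨i, rfl⟩, rfl⟩
          exact ⟨i, by abel⟩
      rw [this, convexHull_vadd, Set.mem_vadd_set_iff_neg_vadd_mem]
      simp
    intro v w hv hw hq
    rw [htr] at hq ⊢
    refine zero_mem_convexHull_of_sign_mixedDet_eq b (fun φ hφ => ?_) hq
    obtain ⟨s, hs⟩ := hY φ ((hS φ).2 hφ)
    rw [hs v hv, hs w hw]
  by_cases hex : ∃ v : Fin (d + 1) → EuclideanSpace ℝ (Fin d), (∀ i, v i ∈ Y i) ∧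
      q ∈ convexHull ℝ (Set.range v)
  · obtain ⟨v, hv, hq⟩ := hex
    exact Or.inl fun w hw => key v w hv hw hq
  · push Not at hex
    exact Or.inr hex

end

/-! ### From homogeneous boxes to bounded colourings and equipartitions. -/

open Classical in
/-- Iterated selection of homogeneous boxes of positive proportion yields a bounded colouring for
which all but a small proportion of the tuples lie in homogeneous boxes of colour classes. The
number of colours does not depend on the notion of homogeneity. -/
theorem exists_coloring_card_filter_le {ι V : Type} [Fintype ι]
    {c : ℝ} (hc : 0 < c) (hc1 : c ≤ 1) (t : ℕ) :
    ∃ (κ : Type) (_ : Fintype κ), ∀ H : (ι → Finset V) → Prop,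
      (∀ X Y, (∀ i, Y i ⊆ X i) → H X → H Y) →
      (∀ X : ι → Finset V, (∀ i, (X i).Nonempty) →
        ∃ Y : ι → Finset V, (∀ i, Y i ⊆ X i) ∧ (∀ i, c * (X i).card ≤ (Y i).card) ∧ H Y) →
      ∀ X : ι → Finset V, ∃ χ : V → κ,
        (((Fintype.piFinset X).filter fun v =>
          ¬ H fun i => (X i).filter fun x => χ x = χ (v i)).card : ℝ) ≤
          (1 - c ^ Fintype.card ι) ^ t * ∏ i, ((X i).card : ℝ) := by
  have hpow : c ^ Fintype.card ι ≤ 1 := pow_le_one₀ hc.le hc1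
  induction t with
  | zero =>
    refine ⟨Unit, inferInstance, fun H _ _ X => ⟨fun _ => (), ?_⟩⟩
    rw [pow_zero, one_mul]
    exact_mod_cast (Finset.card_filter_le _ _).trans_eq (Fintype.card_piFinset X)
  | succ t ih =>
    obtain ⟨κ, _, ih⟩ := ih
    -- A colour records membership in each `Y i` together with the recursive colour for every cell
    -- `Z S`. The cell `Z univ = Y` has no bad tuples, and it holds a proportion at least `c ^ card
    -- ι` of the product.
    refine ⟨(Finset ι → κ) × (ι → Bool), inferInstance, fun H hH h X => ?_⟩
    by_cases hX : ∀ i, (X i).Nonempty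
    swap
    · push Not at hX
      obtain ⟨i, hi⟩ := hX
      obtain ⟨χ, -⟩ := ih H hH h X
      refine ⟨fun v => (fun _ => χ v, fun _ => false), ?_⟩
      have h0 : ∏ i, (X i).card = 0 := Finset.prod_eq_zero (Finset.mem_univ i) (by simp [hi])
      have h1 : ∏ i, ((X i).card : ℝ) = 0 := by exact_mod_cast h0
      rw [h1, mul_zero]
      exact_mod_cast (Finset.card_filter_le _ _).trans_eq ((Fintype.card_piFinset X).trans h0)
    obtain ⟨Y, hYX, hYc, hY⟩ := h X hX
    set Z : Finset ι → ι → Finset V := fun S i => if i ∈ S then Y i else X i \ Y i with hZ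
    choose χ hχ using fun S => ih H hH h (Z S)
    set χ' : V → (Finset ι → κ) × (ι → Bool) :=
      fun x => (fun S => χ S x, fun i => decide (x ∈ Y i)) with hχ'
    refine ⟨χ', ?_⟩
    have hsub : ((Fintype.piFinset X).filter fun v =>
        ¬ H fun i => (X i).filter fun x => χ' x = χ' (v i)) ⊆
        (Finset.univ.erase Finset.univ).biUnion fun S => (Fintype.piFinset (Z S)).filter fun v =>
          ¬ H fun i => (Z S i).filter fun x => χ S x = χ S (v i) := by
      intro v hv
      rw [Finset.mem_filter, Fintype.mem_piFinset] at hv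
      obtain ⟨hvX, hvH⟩ := hv
      set S : Finset ι := Finset.univ.filter fun i => v i ∈ Y i with hS
      have hmemS : ∀ i, i ∈ S ↔ v i ∈ Y i := fun i => by simp [hS]
      have hχmem : ∀ i x, χ' x = χ' (v i) → (x ∈ Y i ↔ v i ∈ Y i) := by
        intro i x hx
        have := congrFun (congrArg Prod.snd hx) i
        simpa [hχ'] using this
      have hcell : ∀ i x, x ∈ X i → χ' x = χ' (v i) → x ∈ Z S i := by
        intro i x hx hχx
        have := hχmem i x hχx
        simp only [hZ]
        split_ifs with hi
        · exact this.2 ((hmemS i).1 hi)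
        · exact Finset.mem_sdiff.2 ⟨hx, fun h' => hi ((hmemS i).2 (this.1 h'))⟩
      refine Finset.mem_biUnion.2 ⟨S, Finset.mem_erase.2 ⟨fun hSu => hvH ?_, Finset.mem_univ _⟩,
        Finset.mem_filter.2 ⟨Fintype.mem_piFinset.2 fun i => hcell i _ (hvX i) rfl, fun hHZ =>
          hvH ?_⟩⟩
      · refine hH Y _ (fun i x hx => ?_) hY
        rw [Finset.mem_filter] at hx
        exact (hχmem i x hx.2).2 ((hmemS i).1 (hSu ▸ Finset.mem_univ i))
      · refine hH _ _ (fun i x hx => ?_) hHZ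
        rw [Finset.mem_filter] at hx ⊢
        exact ⟨hcell i x hx.1 hx.2, congrFun (congrArg Prod.fst hx.2) S⟩
    have hcard := (Finset.card_le_card hsub).trans Finset.card_biUnion_le
    have hcard' : (((Fintype.piFinset X).filter fun v =>
        ¬ H fun i => (X i).filter fun x => χ' x = χ' (v i)).card : ℝ) ≤
        ∑ S ∈ Finset.univ.erase Finset.univ,
          (1 - c ^ Fintype.card ι) ^ t * ∏ i, ((Z S i).card : ℝ) := by
      refine (Nat.cast_le.2 hcard).trans ?_
      rw [Nat.cast_sum]
      exact Finset.sum_le_sum fun S _ => hχ S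
    have hsplit : ∏ i, ((X i).card : ℝ) = ∑ S, ∏ i, ((Z S i).card : ℝ) := by
      have h1 : ∀ i, ((X i).card : ℝ) = (Y i).card + (X i \ Y i).card := fun i => by
        rw [add_comm]; exact_mod_cast (Finset.card_sdiff_add_card_eq_card (hYX i)).symm
      simp only [h1]
      rw [Finset.prod_add, Finset.powerset_univ]
      refine Finset.sum_congr rfl fun S _ => ?_
      simp only [hZ, apply_ite Finset.card, Nat.cast_ite]
      rw [Finset.prod_ite]
      congr 2
      · ext i; simp
      · ext i; simp
    rw [← Finset.add_sum_erase _ _ (Finset.mem_univ Finset.univ)] at hsplit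
    have hZY : ∏ i, ((Z Finset.univ i).card : ℝ) = ∏ i, ((Y i).card : ℝ) := by simp [hZ]
    have hYprod : c ^ Fintype.card ι * ∏ i, ((X i).card : ℝ) ≤ ∏ i, ((Y i).card : ℝ) := by
      rw [← Finset.card_univ, ← Finset.prod_const, ← Finset.prod_mul_distrib]
      exact Finset.prod_le_prod (fun i _ => by positivity) fun i _ => hYc i
    rw [← Finset.mul_sum] at hcard'
    have hfin := hcard'.trans (mul_le_mul_of_nonneg_left
      (show _ ≤ (1 - c ^ Fintype.card ι) * ∏ i, ((X i).card : ℝ) by linarith)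
      (pow_nonneg (sub_nonneg.2 hpow) t))
    rw [← mul_assoc, ← pow_succ] at hfin
    convert! hfin

open Classical in
/-- An equipartition into `k` parts all but boundedly many of which are monochromatic. -/
theorem exists_isEquipartitionInto_card_filter_le {V κ : Type*} [Fintype κ] (P : Finset V)
    (χ : V → κ) {k : ℕ} (hk : k ≠ 0) (hkP : k ≤ P.card) :
    ∃ A : Fin k → Finset V, IsEquipartitionInto P A ∧ (∀ i, P.card / k ≤ (A i).card) ∧
      (Finset.univ.filter fun i => ¬ ∀ x ∈ A i, ∀ y ∈ A i, χ x = χ y).card ≤ Fintype.card κ := by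
  set cls : κ → Finset V := fun a => P.filter fun x => χ x = a with hcls
  let R : Finpartition P := Finpartition.ofExistsUnique ((P.image χ).image cls)
    (by
      intro p hp
      obtain ⟨a, -, rfl⟩ := Finset.mem_image.1 hp
      exact Finset.filter_subset _ _)
    (by
      intro x hx
      refine ⟨cls (χ x), ⟨Finset.mem_image_of_mem _ (Finset.mem_image_of_mem _ hx),
        by simp [hcls, hx]⟩, ?_⟩
      rintro p ⟨hp, hxp⟩
      obtain ⟨a, -, rfl⟩ := Finset.mem_image.1 hp
      rw [(Finset.mem_filter.1 hxp).2])
    (by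
      intro h0
      obtain ⟨a, ha, h⟩ := Finset.mem_image.1 h0
      obtain ⟨x, hx, rfl⟩ := Finset.mem_image.1 ha
      have : x ∈ cls (χ x) := by simp [hcls, hx]
      rw [h] at this
      exact absurd this (Finset.notMem_empty _))
  have hRparts : R.parts = (P.image χ).image cls := rfl
  set m := P.card / k with hm
  have hm0 : m ≠ 0 := (Nat.div_pos hkP (Nat.pos_of_ne_zero hk)).ne'
  have hlt : P.card % k < k := Nat.mod_lt _ (Nat.pos_of_ne_zero hk)
  have hsum : (k - P.card % k) * m + P.card % k * (m + 1) = P.card := by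
    have h1 := Nat.div_add_mod P.card k
    rw [← hm] at h1
    zify [hlt.le] at h1 ⊢
    linarith
  set Q := R.equitabilise hsum with hQ
  have hQc : Q.parts.card = k := by
    rw [hQ, Finpartition.card_parts_equitabilise R hsum hm0]; omega
  set e := (Finset.equivFinOfCardEq hQc).symm with he
  have hAQ : ∀ i, (e i : Finset V) ∈ Q.parts := fun i => (e i).2
  refine ⟨fun i => e i, ⟨fun i j hij => ?_, ?_, fun i j => ?_⟩, fun i => ?_, ?_⟩
  · exact Q.disjoint (hAQ i) (hAQ j) fun h => hij (e.injective (Subtype.ext h))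
  · ext x
    simp only [Set.mem_iUnion, Finset.mem_coe]
    constructor
    · rintro ⟨i, hi⟩
      exact Q.le (hAQ i) hi
    · intro hx
      obtain ⟨p, hp, hxp⟩ := Q.exists_mem hx
      exact ⟨e.symm ⟨p, hp⟩, by simpa using hxp⟩
  · have h1 := Finpartition.card_eq_of_mem_parts_equitabilise (hAQ i)
    have h2 := Finpartition.card_eq_of_mem_parts_equitabilise (hAQ j)
    omega
  · rcases Finpartition.card_eq_of_mem_parts_equitabilise (hAQ i) with h | h <;>
      simp only [h] <;> omega
  set B := Finset.univ.filter fun i => ¬ ∀ x ∈ (e i : Finset V), ∀ y ∈ (e i : Finset V), χ x = χ y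
    with hB
  -- Points of mixed parts are left over when the parts contained in their colour class are removed.
  -- Each class leaves at most `m` such points and each part has at least `m`, so there are at most
  -- `card κ` mixed parts.
  have hsub : B.biUnion (fun i => (e i : Finset V)) ⊆
      R.parts.biUnion fun p => p \ (Q.parts.filter fun u => u ⊆ p).biUnion id := by
    intro x hx
    obtain ⟨i, hi, hxi⟩ := Finset.mem_biUnion.1 hx
    obtain ⟨p, hp, hxp⟩ := R.exists_mem (Q.le (hAQ i) hxi)
    refine Finset.mem_biUnion.2 ⟨p, hp, Finset.mem_sdiff.2 ⟨hxp, fun hmem => ?_⟩⟩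
    obtain ⟨u, hu, hxu⟩ := Finset.mem_biUnion.1 hmem
    rw [Finset.mem_filter] at hu
    have hui : u = e i := Q.eq_of_mem_parts hu.1 (hAQ i) hxu hxi
    rw [hRparts] at hp
    obtain ⟨a, -, rfl⟩ := Finset.mem_image.1 hp
    refine (Finset.mem_filter.1 hi).2 fun y hy z hz => ?_
    rw [(Finset.mem_filter.1 (hu.2 (hui ▸ hy))).2, (Finset.mem_filter.1 (hu.2 (hui ▸ hz))).2]
  have h1 : B.card * m ≤ (B.biUnion fun i => (e i : Finset V)).card := by
    have hdisj : ∀ i ∈ B, ∀ j ∈ B, i ≠ j → Disjoint (e i : Finset V) (e j) := fun i _ j _ hij =>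
      Q.disjoint (hAQ i) (hAQ j) fun h => hij (e.injective (Subtype.ext h))
    rw [Finset.card_biUnion hdisj]
    refine (Finset.card_nsmul_le_sum B _ m fun i _ => ?_).trans_eq' (by simp)
    have h1 := Finpartition.card_eq_of_mem_parts_equitabilise (hAQ i)
    omega
  have h2 : (R.parts.biUnion fun p => p \ (Q.parts.filter fun u => u ⊆ p).biUnion id).card ≤
      Fintype.card κ * m := by
    refine Finset.card_biUnion_le.trans ((Finset.sum_le_card_nsmul _ _ m fun p hp =>
      R.card_parts_equitabilise_subset_le hsum hp).trans ?_)
    rw [smul_eq_mul]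
    refine Nat.mul_le_mul_right _ ?_
    rw [hRparts]
    exact Finset.card_image_le.trans (Finset.card_le_univ _)
  exact Nat.le_of_mul_le_mul_right (h1.trans ((Finset.card_le_card hsub).trans h2))
    (Nat.pos_of_ne_zero hm0)

theorem IsHomogeneous.mono {d : ℕ} {q : EuclideanSpace ℝ (Fin d)}
    {S T : Fin (d + 1) → Set (EuclideanSpace ℝ (Fin d))} (h : IsHomogeneous q S)
    (hTS : ∀ i, T i ⊆ S i) : IsHomogeneous q T :=
  h.imp (fun h v hv => h v fun i => hTS i (hv i)) fun h v hv => h v fun i => hTS i (hv i)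

theorem isHomogeneous_of_subsingleton {d : ℕ} {q : EuclideanSpace ℝ (Fin d)}
    {S : Fin (d + 1) → Set (EuclideanSpace ℝ (Fin d))} (h : ∀ i, (S i).Subsingleton) :
    IsHomogeneous q S := by
  by_cases hex : ∃ v : Fin (d + 1) → EuclideanSpace ℝ (Fin d), (∀ i, v i ∈ S i) ∧
      q ∈ convexHull ℝ (Set.range v)
  · obtain ⟨v, hv, hq⟩ := hex
    refine Or.inl fun w hw => ?_
    rwa [funext fun i => h i (hw i) (hv i)]
  · push Not at hex
    exact Or.inr hex

theorem exists_isEquipartitionInto_of_card_lt {V : Type*} (P : Finset V) {k : ℕ}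
    (hk : P.card < k) : ∃ A : Fin k → Finset V, IsEquipartitionInto P A ∧ ∀ i, (A i).card ≤ 1 := by
  classical
  set e := P.equivFin with he
  have hA : ∀ i : Fin k, (P.filter fun x => ∃ h : x ∈ P, (e ⟨x, h⟩ : ℕ) = i).card ≤ 1 := by
    intro i
    rw [Finset.card_le_one]
    intro x hx y hy
    obtain ⟨-, hx', hx⟩ := Finset.mem_filter.1 hx
    obtain ⟨-, hy', hy⟩ := Finset.mem_filter.1 hy
    exact congrArg Subtype.val (e.injective (Fin.ext (hx.trans hy.symm)))
  refine ⟨fun i => P.filter fun x => ∃ h : x ∈ P, (e ⟨x, h⟩ : ℕ) = i, ⟨fun i j hij => ?_, ?_,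
    fun i j => (hA i).trans (by omega)⟩, hA⟩
  · rw [Finset.disjoint_left]
    intro x hx hy
    obtain ⟨-, hx', hx⟩ := Finset.mem_filter.1 hx
    obtain ⟨-, hy', hy⟩ := Finset.mem_filter.1 hy
    exact hij (Fin.ext (hx.symm.trans hy))
  · ext x
    simp only [Set.mem_iUnion, Finset.mem_coe, Finset.mem_filter]
    exact ⟨fun ⟨i, hi⟩ => hi.1, fun hx => ⟨⟨e ⟨x, hx⟩, (e ⟨x, hx⟩).2.trans hk⟩, hx, hx, rfl⟩⟩

/-! ### Counting tuples of parts. -/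

/-- Tuples of parts all of whose transversals are bad. -/
theorem card_mul_pow_le_of_piFinset_subset {V : Type*} [DecidableEq V] {m k a : ℕ}
    {A : Fin k → Finset V} (hA : ∀ i j, i ≠ j → Disjoint (A i) (A j)) (ha : ∀ i, a ≤ (A i).card)
    (T : Finset (Fin m → Fin k)) (B : Finset (Fin m → V))
    (hT : ∀ t ∈ T, Fintype.piFinset (fun i => A (t i)) ⊆ B) : T.card * a ^ m ≤ B.card := by
  classical
  have hdisj : ∀ s ∈ T, ∀ t ∈ T, s ≠ t →
      Disjoint (Fintype.piFinset fun i => A (s i)) (Fintype.piFinset fun i => A (t i)) := by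
    intro s _ t _ hst
    obtain ⟨i, hi⟩ := Function.ne_iff.1 hst
    rw [Finset.disjoint_left]
    intro v hv hv'
    exact Finset.disjoint_left.1 (hA _ _ hi) (Fintype.mem_piFinset.1 hv i)
      (Fintype.mem_piFinset.1 hv' i)
  refine le_trans ?_ (Finset.card_le_card (Finset.biUnion_subset.2 hT))
  rw [Finset.card_biUnion hdisj]
  refine (Finset.card_nsmul_le_sum T _ (a ^ m) fun t _ => ?_).trans_eq' (by simp)
  rw [Fintype.card_piFinset]
  exact (Finset.prod_le_prod' fun i _ => ha (t i)).trans_eq' (by simp)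

/-- A union bound over the position that meets `B`; the factor `k` on the left avoids the exponent
`m - 1`. -/
theorem card_filter_exists_mem_mul_le {m k : ℕ} (B : Finset (Fin k)) :
    (Finset.univ.filter fun t : Fin m → Fin k => ∃ i, t i ∈ B).card * k ≤ m * B.card * k ^ m := by
  classical
  have hsub : (Finset.univ.filter fun t : Fin m → Fin k => ∃ i, t i ∈ B) ⊆
      Finset.univ.biUnion fun i : Fin m => Fintype.piFinset (Function.update (fun _ : Fin m => (Finset.univ : Finset (Fin k))) i B) := by
    intro t ht
    obtain ⟨i, hi⟩ := (Finset.mem_filter.1 ht).2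
    refine Finset.mem_biUnion.2 ⟨i, Finset.mem_univ _, Fintype.mem_piFinset.2 fun j => ?_⟩
    rcases eq_or_ne j i with rfl | hj
    · rwa [Function.update_self]
    · rw [Function.update_of_ne hj]; exact Finset.mem_univ _
  have hcard : ∀ i : Fin m,
      (Fintype.piFinset (Function.update (fun _ : Fin m => (Finset.univ : Finset (Fin k))) i B)).card * k = B.card * k ^ m := by
    intro i
    rw [Fintype.card_piFinset, ← Finset.mul_prod_erase _ _ (Finset.mem_univ i),
      Function.update_self, mul_assoc]
    congr 1
    rw [Finset.prod_congr rfl (g := fun _ => k) fun j hj => by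
      rw [Function.update_of_ne (Finset.ne_of_mem_erase hj), Finset.card_univ, Fintype.card_fin],
      Finset.prod_const, Finset.card_erase_of_mem (Finset.mem_univ i), Finset.card_univ,
      Fintype.card_fin, ← pow_succ, Nat.sub_add_cancel (Nat.one_le_of_lt i.2)]
  refine (Nat.mul_le_mul_right k ((Finset.card_le_card hsub).trans Finset.card_biUnion_le)).trans ?_
  rw [Finset.sum_mul, Finset.sum_congr rfl fun i _ => hcard i, Finset.sum_const, Finset.card_univ,
    Fintype.card_fin, smul_eq_mul, mul_assoc]

theorem corollary1p8 (d : ℕ) (hd : 1 ≤ d) (ε : ℝ) (hε : 0 < ε) :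
    ∃ K : ℕ, d + 1 ≤ K ∧ ∀ k : ℕ, K ≤ k →
      ∀ (P : Finset (EuclideanSpace ℝ (Fin d))) (q : EuclideanSpace ℝ (Fin d)),
        ∃ A : Fin k → Finset (EuclideanSpace ℝ (Fin d)),
          IsEquipartitionInto P A ∧
          (({t : Fin (d + 1) ↪ Fin k |
              ¬ IsHomogeneous q (fun i => (A (t i) : Set (EuclideanSpace ℝ (Fin d))))}.ncard : ℕ) : ℝ)
            ≤ ε * (Nat.card (Fin (d + 1) ↪ Fin k) : ℝ) := by
  classical
  obtain ⟨c, hc, hsel⟩ := exists_subsets_isHomogeneous d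
  have hc' : 0 < min c 1 := lt_min hc one_pos
  -- The budget is `ε / 2 * (k / 2) ^ (d + 1)` for each of the two kinds of bad tuples. The `4 ^ (d
  -- + 1)` combines this `2 ^ (d + 1)` with the loss in `n ≤ 2 * k * m`.
  obtain ⟨s, hs⟩ := exists_pow_lt_of_lt_one
    (show (0 : ℝ) < ε / (2 * 4 ^ (d + 1)) by positivity)
    (show 1 - min c 1 ^ (d + 1) < 1 by linarith [pow_pos hc' (d + 1)])
  obtain ⟨κ, _, hκ⟩ := exists_coloring_card_filter_le (ι := Fin (d + 1))
    (V := EuclideanSpace ℝ (Fin d)) hc' (min_le_right c 1) s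
  set M := Fintype.card κ with hM
  obtain ⟨K, hK⟩ := exists_nat_ge (2 * 2 ^ (d + 1) * ((d + 1 : ℕ) * M) / ε)
  refine ⟨max K (2 * (d + 1)), le_max_of_le_right (by omega), fun k hk P q => ?_⟩
  have hkK : K ≤ k := (le_max_left _ _).trans hk
  have hkd : 2 * (d + 1) ≤ k := (le_max_right _ _).trans hk
  rcases Nat.lt_or_ge P.card k with hlt | hge
  · obtain ⟨A, hA, hA1⟩ := exists_isEquipartitionInto_of_card_lt P hlt
    refine ⟨A, hA, ?_⟩
    have : {t : Fin (d + 1) ↪ Fin k |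
        ¬ IsHomogeneous q (fun i => (A (t i) : Set (EuclideanSpace ℝ (Fin d))))} = ∅ := by
      ext t
      simp only [Set.mem_ofPred_eq, Set.mem_empty_iff_false, iff_false, not_not]
      exact isHomogeneous_of_subsingleton fun i => by
        have := Finset.card_le_one.1 (hA1 (t i))
        exact fun x hx y hy => this x hx y hy
    rw [this, Set.ncard_empty, Nat.cast_zero]
    positivity
  let H : (Fin (d + 1) → Finset (EuclideanSpace ℝ (Fin d))) → Prop :=
    fun X => IsHomogeneous q fun i => (X i : Set (EuclideanSpace ℝ (Fin d)))
  obtain ⟨χ, hχ⟩ := hκ H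
    (fun X Y hYX hX => hX.mono fun i => Finset.coe_subset.2 (hYX i))
    (fun X hX => by
      obtain ⟨Y, hYX, hYc, hY⟩ := hsel q X hX
      exact ⟨Y, hYX, fun i => (mul_le_mul_of_nonneg_right (min_le_left _ _)
        (Nat.cast_nonneg _)).trans (hYc i), hY⟩) fun _ => P
  obtain ⟨A, hA, hAcard, hAmono⟩ := exists_isEquipartitionInto_card_filter_le P χ
    (show k ≠ 0 by omega) hge
  refine ⟨A, hA, ?_⟩
  set B := Finset.univ.filter fun i => ¬ ∀ x ∈ A i, ∀ y ∈ A i, χ x = χ y with hB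
  -- `T₁` collects the tuples meeting a mixed part, `T₂` the non-homogeneous tuples of monochromatic
  -- parts. Repeated indices are allowed in both, which only enlarges the count.
  set T₁ := Finset.univ.filter fun t : Fin (d + 1) → Fin k => ∃ i, t i ∈ B with hT₁
  set T₂ := Finset.univ.filter fun t : Fin (d + 1) → Fin k =>
    (∀ i, t i ∉ B) ∧ ¬ H fun i => A (t i) with hT₂
  set Bad := (Fintype.piFinset fun _ : Fin (d + 1) => P).filter fun v =>
    ¬ H fun i => P.filter fun x => χ x = χ (v i) with hBad
  have hAP : ∀ i, A i ⊆ P := fun i x hx => by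
    have : x ∈ (⋃ i, (A i : Set (EuclideanSpace ℝ (Fin d)))) := Set.mem_iUnion.2 ⟨i, hx⟩
    rwa [hA.union_eq] at this
  have hcount : {t : Fin (d + 1) ↪ Fin k | ¬ IsHomogeneous q
      (fun i => (A (t i) : Set (EuclideanSpace ℝ (Fin d))))}.ncard ≤ T₁.card + T₂.card := by
    rw [← Set.ncard_image_of_injective _ (DFunLike.coe_injective (F := Fin (d + 1) ↪ Fin k))]
    refine le_trans ?_ (Finset.card_union_le T₁ T₂)
    rw [← Set.ncard_coe_finset]
    refine Set.ncard_le_ncard ?_ (Finset.finite_toSet _)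
    rintro _ ⟨t, ht, rfl⟩
    rw [Finset.mem_coe, Finset.mem_union]
    by_cases h : ∃ i, t i ∈ B
    · exact Or.inl (Finset.mem_filter.2 ⟨Finset.mem_univ _, h⟩)
    · push Not at h
      exact Or.inr (Finset.mem_filter.2 ⟨Finset.mem_univ _, h, ht⟩)
  have h₁ : T₁.card * k ≤ (d + 1) * M * k ^ (d + 1) :=
    (card_filter_exists_mem_mul_le B).trans
      (Nat.mul_le_mul_right _ (Nat.mul_le_mul_left _ hAmono))
  have h₂ := card_mul_pow_le_of_piFinset_subset hA.disjoint hAcard T₂ Bad (fun t ht v hv => by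
    obtain ⟨-, htB, htH⟩ := Finset.mem_filter.1 ht
    have hv' := Fintype.mem_piFinset.1 hv
    refine Finset.mem_filter.2 ⟨Fintype.mem_piFinset.2 fun i => hAP _ (hv' i), fun hcell => htH ?_⟩
    refine IsHomogeneous.mono hcell fun i x hx => ?_
    have hmono : ∀ x ∈ A (t i), ∀ y ∈ A (t i), χ x = χ y := by
      by_contra hcon
      exact htB i (Finset.mem_filter.2 ⟨Finset.mem_univ _, hcon⟩)
    exact Finset.mem_coe.2 (Finset.mem_filter.2 ⟨hAP _ hx, hmono x hx _ (hv' i)⟩))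
  rw [Fintype.card_fin, Finset.prod_const, Finset.card_univ, Fintype.card_fin] at hχ
  set n := P.card with hn
  set m := n / k with hm
  have hk0 : 0 < k := by omega
  have hm0 : 0 < m := Nat.div_pos hge hk0
  have hkR : (0 : ℝ) < k := by exact_mod_cast hk0
  have hmR : (0 : ℝ) < m := by exact_mod_cast hm0
  have hn2 : (n : ℝ) ≤ 2 * k * m := by
    have h1 := Nat.lt_mul_div_succ n hk0
    rw [← hm] at h1
    have h3 : n ≤ 2 * k * m := by nlinarith
    exact_mod_cast h3
  have h₂R : (T₂.card : ℝ) ≤ ε / (2 * 4 ^ (d + 1)) * (2 * k) ^ (d + 1) := by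
    have h3 : (T₂.card : ℝ) * (m : ℝ) ^ (d + 1) ≤ ε / (2 * 4 ^ (d + 1)) * (n : ℝ) ^ (d + 1) := by
      have h4 : (Bad.card : ℝ) ≤ (1 - min c 1 ^ (d + 1)) ^ s * (n : ℝ) ^ (d + 1) := by
        convert! hχ
      refine le_trans ?_ (h4.trans (mul_le_mul_of_nonneg_right hs.le (by positivity)))
      exact_mod_cast h₂
    have h4 : (n : ℝ) ^ (d + 1) ≤ (2 * k) ^ (d + 1) * (m : ℝ) ^ (d + 1) := by
      rw [← mul_pow]
      exact pow_le_pow_left₀ (Nat.cast_nonneg _) hn2 _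
    refine le_of_mul_le_mul_right (h3.trans ?_) (pow_pos hmR (d + 1))
    rw [mul_assoc]
    exact mul_le_mul_of_nonneg_left h4 (by positivity)
  have h₁R : (T₁.card : ℝ) ≤ ε / (2 * 2 ^ (d + 1)) * (k : ℝ) ^ (d + 1) := by
    have h3 : (T₁.card : ℝ) * k ≤ ((d + 1 : ℕ) * M : ℝ) * (k : ℝ) ^ (d + 1) := by
      exact_mod_cast h₁
    have h4 : ((d + 1 : ℕ) * M : ℝ) ≤ ε / (2 * 2 ^ (d + 1)) * k := by
      have h5 := hK.trans (Nat.cast_le.2 hkK)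
      rw [div_le_iff₀ hε] at h5
      rw [div_mul_eq_mul_div, le_div_iff₀ (by positivity)]
      linarith
    refine le_of_mul_le_mul_right (h3.trans ?_) hkR
    rw [mul_right_comm _ _ (k : ℝ)]
    exact mul_le_mul_of_nonneg_right h4 (by positivity)
  -- Each factor of the falling factorial is at least `k - d ≥ k / 2`, because `k ≥ 2 * (d + 1)`.
  have hdesc : ((k : ℝ) / 2) ^ (d + 1) ≤ (Nat.card (Fin (d + 1) ↪ Fin k) : ℝ) := by
    rw [Nat.card_eq_fintype_card, Fintype.card_embedding_eq, Fintype.card_fin, Fintype.card_fin]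
    refine le_trans ?_ (Nat.cast_le.2 (Nat.pow_sub_le_descFactorial k (d + 1)))
    rw [Nat.cast_pow]
    refine pow_le_pow_left₀ (by positivity) ?_ _
    rw [div_le_iff₀ two_pos]
    have : k ≤ (k + 1 - (d + 1)) * 2 := by omega
    exact_mod_cast this
  refine (Nat.cast_le.2 hcount).trans (le_trans ?_ (mul_le_mul_of_nonneg_left hdesc hε.le))
  rw [Nat.cast_add]
  refine (add_le_add h₁R h₂R).trans_eq ?_
  rw [div_pow, mul_pow, show (4 : ℝ) = 2 * 2 by norm_num, mul_pow]
  field_simp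
  ring
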